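/- **Setting.** There are $n$ jobs with unknown processing times $p_1,\dots,p_n\ge 0$ on a single unit-speed machine that may be shared between jobs (arbitrary preemption). Let $e_j(t)$ be the processing that job $j$ has received until time $t$ and let $C_j$ be its completion time, the earliest $t\ge 0$ with $e_j(t)\ge p_j$. The cost of a schedule is $\sum_j C_j$; $\mathrm{OPT}$ is the least cost of any schedule of the jobs. A number $\alpha\in(0,1]$ is known; job $j$ emits a signal when its elapsed time reaches $\beta_j p_j$, where $\beta_j\in[0,1]$ is unknown. **Algorithm.** Let $\rho\in(0,1]$. Run Shortest Elapsed Time First (SETF) on the uncompleted jobs, i.e. at each moment process at equal rates (of sum $1$) all uncompleted jobs of least elapsed time. Whenever a job $j$ emits its signal, at a time $t$, interrupt SETF and run $j$ alone for $\left(\frac{1}{\alpha\rho}-1\right)e_j(t)$ units of time, or until it completes if this happens earlier; then resume. Jobs that emit their signals at the same time get this preferential execution one after the other, in an arbitrary order. $\mathrm{ALG}$ denotes the cost of the resulting schedule. **Theorem.** For all $\alpha,\rho\in(0,1]$, the algorithm has an execution on every instance, each of its executions is a schedule that completes all jobs, and for all $n$, all $p_1,\dots,p_n\ge 0$ and all ways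 of ordering simultaneous signals: 1. ($(1+\alpha)$-consistency) if $\beta_j=\alpha$ for all $j$, then $\mathrm{ALG}\le(1+\alpha)\,\mathrm{OPT}$; 2. ($(1+\frac1{\rho\alpha})$-robustness) for all $\beta_1,\dots,\beta_n\in[0,1]$, $\mathrm{ALG}\le\left(1+\frac{1}{\rho\alpha}\right)\mathrm{OPT}$; 3. if $\rho\in(0,1)$, then for all $\beta_1,\dots,\beta_n\in[0,1]$, $$\mathrm{ALG}\le(1+\alpha)\,\mathrm{OPT}+\frac{2n}{\rho(1-\rho)\alpha^2}\sum_{i=1}^n|\beta_i-\alpha|\,p_i .$$ -/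

import Mathlib

noncomputable section

namespace SignalScheduling

/-! ### Preemptive schedules on a single machine -/

/-- `e j t` is the processing that job `j` has received until time `t`. The machine has unit
speed and may be shared between jobs (arbitrary, infinitesimal preemption); every job is
eventually completed. Only times `t ≥ 0` matter. -/
structure IsSchedule {n : ℕ} (p : Fin n → ℝ) (e : Fin n → ℝ → ℝ) : Prop where
  start : ∀ j, e j 0 = 0
  mono : ∀ j, ∀ s t : ℝ, 0 ≤ s → s ≤ t → e j s ≤ e j t
  speed : ∀ s t : ℝ, 0 ≤ s → s ≤ t → ∑ j, (e j t - e j s) ≤ t - s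
  completes : ∀ j, ∃ t : ℝ, 0 ≤ t ∧ p j ≤ e j t

/-- Completion time: the earliest `t ≥ 0` with `e j t ≥ p j`. -/
def completionTime {n : ℕ} (p : Fin n → ℝ) (e : Fin n → ℝ → ℝ) (j : Fin n) : ℝ :=
  sInf {t : ℝ | 0 ≤ t ∧ p j ≤ e j t}

/-- The objective: the total completion time. -/
def totalCompletionTime {n : ℕ} (p : Fin n → ℝ) (e : Fin n → ℝ → ℝ) : ℝ :=
  ∑ j, completionTime p e j

/-- The optimal total completion time over all preemptive schedules. -/
def OPT {n : ℕ} (p : Fin n → ℝ) : ℝ :=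
  sInf {c : ℝ | ∃ e : Fin n → ℝ → ℝ, IsSchedule p e ∧ c = totalCompletionTime p e}

/-! ### The algorithm

Shortest Elapsed Time First, interrupted by preferential executions: when job `j` emits its
signal, i.e. when its elapsed time reaches `β j * p j`, it is run alone for
`(1 / (α * ρ) - 1) * e_j` time units, or until it completes if this happens earlier. -/

/-- State of the algorithm between two phases. -/
structure State (n : ℕ) where
  /-- the current time -/
  time : ℝ
  /-- the elapsed time of each job -/
  elapsed : Fin n → ℝ
  /-- the jobs that have already received their preferential execution -/
  served : Finset (Fin n)

/-- The initial state. -/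
def State.init (n : ℕ) : State n := ⟨0, fun _ => 0, ∅⟩

/-- Job `j` is not completed. -/
def Unfinished {n : ℕ} (p : Fin n → ℝ) (s : State n) (j : Fin n) : Prop :=
  s.elapsed j < p j

/-- Job `j` is not completed, has emitted its signal, and still waits for its preferential
execution. -/
def Pending {n : ℕ} (p β : Fin n → ℝ) (s : State n) (j : Fin n) : Prop :=
  Unfinished p s j ∧ β j * p j ≤ s.elapsed j ∧ j ∉ s.served

open Classical in
/-- The uncompleted jobs of least elapsed time: the jobs that SETF processes. -/
def lowest {n : ℕ} (p : Fin n → ℝ) (s : State n) : Finset (Fin n) :=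
  Finset.univ.filter fun j =>
    Unfinished p s j ∧ ∀ i, Unfinished p s i → s.elapsed j ≤ s.elapsed i

/-- All jobs that SETF currently processes can receive a further amount `x` each without passing
an event: the completion or the signal of one of them, or the moment at which they catch up
with another uncompleted job. -/
def NoEventBefore {n : ℕ} (p β : Fin n → ℝ) (s : State n) (x : ℝ) : Prop :=
  0 ≤ x ∧ ∀ j ∈ lowest p s,
    s.elapsed j + x ≤ p j ∧
    (j ∉ s.served → s.elapsed j + x ≤ β j * p j) ∧
    ∀ i, Unfinished p s i → i ∉ lowest p s → s.elapsed j + x ≤ s.elapsed i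

open Classical in
/-- `Phase α ρ p β s d r S`: from state `s` the algorithm may run, for `d` time units, every job
`j` at the constant rate `r j`, after which `S` is the set of jobs that have received their
preferential execution. Signals emitted simultaneously are served one after the other, in an
arbitrary order. -/
inductive Phase {n : ℕ} (α ρ : ℝ) (p β : Fin n → ℝ) (s : State n) :
    ℝ → (Fin n → ℝ) → Finset (Fin n) → Prop
  /-- preferential execution of `j`, stopped early if `j` completes -/
  | prefer (j : Fin n) (hj : Pending p β s j) :
      Phase α ρ p β s (min ((1 / (α * ρ) - 1) * s.elapsed j) (p j - s.elapsed j))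
        (fun i => if i = j then 1 else 0) (insert j s.served)
  /-- SETF up to the next event -/
  | setf (x : ℝ) (hp : ∀ j, ¬ Pending p β s j) (hu : ∃ j, Unfinished p s j)
      (hx : IsGreatest {y : ℝ | NoEventBefore p β s y} x) :
      Phase α ρ p β s ((lowest p s).card * x)
        (fun i => if i ∈ lowest p s then 1 / ((lowest p s).card : ℝ) else 0) s.served
  /-- all jobs are completed: the machine idles (one unit of time after the other) -/
  | idle (hu : ∀ j, ¬ Unfinished p s j) :
      Phase α ρ p β s 1 (fun _ => 0) s.served

/-- `e` is the evolution of the elapsed times in an execution of the algorithm with parameters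
`α`, `ρ` on jobs with processing times `p` that emit their signals after the fractions `β`. -/
def IsExecution (α ρ : ℝ) {n : ℕ} (p β : Fin n → ℝ) (e : Fin n → ℝ → ℝ) : Prop :=
  ∃ (s : ℕ → State n) (d : ℕ → ℝ) (r : ℕ → Fin n → ℝ),
    s 0 = State.init n ∧
    ∀ m,
      Phase α ρ p β (s m) (d m) (r m) (s (m + 1)).served ∧
      (s (m + 1)).time = (s m).time + d m ∧
      (∀ j, (s (m + 1)).elapsed j = (s m).elapsed j + d m * r m j) ∧
      ∀ j, ∀ t ∈ Set.Icc (s m).time (s (m + 1)).time,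
        e j t = (s m).elapsed j + (t - (s m).time) * r m j

/-! ### Performance guarantees -/

/-- A scheduling algorithm with signals, given by its possible executions on each instance
`(n, p, β)`. -/
abbrev Algorithm : Type := ∀ {n : ℕ}, (Fin n → ℝ) → (Fin n → ℝ) → (Fin n → ℝ → ℝ) → Prop

/-- An instance: processing times and signal fractions in `[0, 1]`. -/
structure IsInstance {n : ℕ} (p β : Fin n → ℝ) : Prop where
  processing_nonneg : ∀ j, 0 ≤ p j
  fraction_mem : ∀ j, β j ∈ Set.Icc (0 : ℝ) 1

/-- On every instance the algorithm has an execution, and each of its executions is a schedule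
that completes all jobs. -/
def IsWellDefined (A : Algorithm) : Prop :=
  ∀ (n : ℕ) (p β : Fin n → ℝ), IsInstance p β →
    (∃ e, A p β e) ∧ ∀ e, A p β e → IsSchedule p e

/-- `c`-consistency: the competitive ratio is at most `c` if all signals are accurate. -/
def IsConsistent (α : ℝ) (A : Algorithm) (c : ℝ) : Prop :=
  ∀ (n : ℕ) (p β : Fin n → ℝ), IsInstance p β → (∀ j, β j = α) →
    ∀ e, A p β e → totalCompletionTime p e ≤ c * OPT p

/-- `c`-robustness: the competitive ratio is at most `c` for arbitrary signals. -/
def IsRobust (A : Algorithm) (c : ℝ) : Prop :=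
  ∀ (n : ℕ) (p β : Fin n → ℝ), IsInstance p β →
    ∀ e, A p β e → totalCompletionTime p e ≤ c * OPT p

end SignalScheduling

end

noncomputable section

namespace SignalScheduling

variable {n : ℕ} {α ρ : ℝ} {p β : Fin n → ℝ}

/-! ### Optimal schedules -/

/-! Costs are compared pair by pair. In any schedule, whichever of two jobs finishes later waits for
the whole of the other, so their mutual delay is at least the smaller processing time. The algorithm
never idles before a job completes, so `C_j` is at most the sum of all elapsed times at that moment.
By `totalCompletionTime_le_of_mutual_delay` it then suffices to bound the mutual delay of each pair
by `K` times the smaller processing time plus an error.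

Robustness (`IsRun.mutual_delay_le`): SETF lifts no job above an uncompleted job `i`, and
preferential execution multiplies an elapsed time by at most `1 / (α * ρ)`. Hence no job receives
more than `p i / (α * ρ)` before `i` completes.

Consistency (`IsRun.mutual_delay_le_of_signal`): a signal with `β ≥ α * ρ` leads to completion
without further interruption. Of two such jobs, one completes while the other has received at most
the fraction `β` of its processing time; this gives `1 + α` up to the signal errors. If instead some
`β < α * ρ`, then `|β - α| > α * (1 - ρ)`, and this error pays for the robustness bound.

The bounds are proved by invariants (`Sound`, `Leads`) of the discrete sequence of states;
`potential` gives termination, and the continuous-time execution is the linear interpolation. -/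

theorem IsSchedule.sub_le_sub {e : Fin n → ℝ → ℝ} (h : IsSchedule p e) (j : Fin n) {s t : ℝ}
    (hs : 0 ≤ s) (hst : s ≤ t) : e j t - e j s ≤ t - s :=
  (Finset.single_le_sum (f := fun i => e i t - e i s)
    (fun i _ => sub_nonneg.2 (h.mono i s t hs hst)) (Finset.mem_univ j)).trans (h.speed s t hs hst)

theorem completionTime_nonneg (p : Fin n → ℝ) (e : Fin n → ℝ → ℝ) (j : Fin n) :
    0 ≤ completionTime p e j :=
  Real.sInf_nonneg fun _ ht => ht.1

theorem completionTime_le {e : Fin n → ℝ → ℝ} {j : Fin n} {t : ℝ} (ht : 0 ≤ t)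
    (h : p j ≤ e j t) : completionTime p e j ≤ t :=
  csInf_le ⟨0, fun _ hx => hx.1⟩ ⟨ht, h⟩

/-- The infimum in the definition of the completion time is attained. -/
theorem IsSchedule.le_at_completionTime {e : Fin n → ℝ → ℝ} (h : IsSchedule p e) (j : Fin n) :
    p j ≤ e j (completionTime p e j) := by
  refine le_of_forall_pos_le_add fun ε hε => ?_
  obtain ⟨t, ⟨ht0, htp⟩, ht⟩ := exists_lt_of_csInf_lt (s := {t : ℝ | 0 ≤ t ∧ p j ≤ e j t})
    (h.completes j) (lt_add_of_pos_right (completionTime p e j) hε)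
  -- Unit speed makes `e j` 1-Lipschitz, so at the infimum less than `ε` is missing.
  have := h.sub_le_sub j (completionTime_nonneg p e j) (completionTime_le ht0 htp)
  linarith

theorem IsSchedule.nonneg {e : Fin n → ℝ → ℝ} (h : IsSchedule p e) (j : Fin n) {t : ℝ}
    (ht : 0 ≤ t) : 0 ≤ e j t := by
  simpa [h.start j] using h.mono j 0 t le_rfl ht

theorem IsSchedule.sum_le_completionTime {e : Fin n → ℝ → ℝ} (h : IsSchedule p e) (j : Fin n) :
    ∑ i, e i (completionTime p e j) ≤ completionTime p e j := by
  simpa [h.start] using h.speed 0 _ le_rfl (completionTime_nonneg p e j)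

/-- Of two jobs, one delays the other by at least the smaller processing time. -/
theorem IsSchedule.min_le_mutual_delay {e : Fin n → ℝ → ℝ} (h : IsSchedule p e) (i j : Fin n) :
    min (p i) (p j) ≤ e i (completionTime p e j) + e j (completionTime p e i) := by
  have hi := completionTime_nonneg p e i
  have hj := completionTime_nonneg p e j
  rcases le_total (completionTime p e i) (completionTime p e j) with hij | hij
  · linarith [min_le_left (p i) (p j), h.le_at_completionTime i, h.mono i _ _ hi hij,
      h.nonneg j hi]
  · linarith [min_le_right (p i) (p j), h.le_at_completionTime j, h.mono j _ _ hj hij,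
      h.nonneg i hj]

/-- Pairwise comparison with the optimum: `a i j` bounds the delay that job `i` causes to
job `j`. -/
theorem totalCompletionTime_le_of_mutual_delay {e : Fin n → ℝ → ℝ} (he : IsSchedule p e)
    {a : Fin n → Fin n → ℝ} {K : ℝ} {err : Fin n → ℝ} (hK : 1 ≤ K) (hp : ∀ j, 0 ≤ p j)
    (herr : ∀ j, 0 ≤ err j)
    (hC : ∀ j, completionTime p e j ≤ ∑ i, a i j) (hdiag : ∀ j, a j j ≤ p j)
    (hpair : ∀ i j, i ≠ j → p i ≤ p j → a i j + a j i ≤ K * p i + (err i + err j)) :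
    totalCompletionTime p e ≤ K * OPT p + n * ∑ i, err i := by
  have hK0 : 0 < K := by linarith
  suffices H : (totalCompletionTime p e - n * ∑ i, err i) / K ≤ OPT p by
    rw [div_le_iff₀ hK0] at H
    linarith
  refine le_csInf ⟨_, e, he, rfl⟩ ?_
  rintro c ⟨e', he', rfl⟩
  rw [div_le_iff₀ hK0]
  have key : ∀ i j, a i j + a j i ≤
      K * (e' i (completionTime p e' j) + e' j (completionTime p e' i)) + (err i + err j) := by
    intro i j
    have hmin := mul_le_mul_of_nonneg_left (he'.min_le_mutual_delay i j) hK0.le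
    by_cases hij : i = j
    -- On the diagonal `2 * a i i ≤ 2 * p i ≤ 2 * K * p i`, which needs `1 ≤ K`.
    · subst hij
      nlinarith [hdiag i, he'.le_at_completionTime i, herr i, hp i,
        mul_le_mul_of_nonneg_left (he'.le_at_completionTime i) hK0.le]
    · rcases le_total (p i) (p j) with h | h
      · rw [min_eq_left h] at hmin
        linarith [hpair i j hij h]
      · rw [min_eq_right h] at hmin
        linarith [hpair j i (Ne.symm hij) h]
  -- Summing over all ordered pairs counts every delay twice; the errors add up to `2 * n * ∑ i, err
  -- i`.
  have hsum := Finset.sum_le_sum fun i (_ : i ∈ Finset.univ) =>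
    Finset.sum_le_sum fun j (_ : j ∈ Finset.univ) => key i j
  simp only [Finset.sum_add_distrib, ← Finset.mul_sum, Finset.sum_const, Finset.card_univ,
    Fintype.card_fin, nsmul_eq_mul] at hsum
  rw [Finset.sum_comm (f := fun i j => a i j),
    Finset.sum_comm (f := fun i j => e' i (completionTime p e' j))] at hsum
  have h1 : totalCompletionTime p e ≤ ∑ j, ∑ i, a i j := Finset.sum_le_sum fun j _ => hC j
  have h2 : ∑ j, ∑ i, e' i (completionTime p e' j) ≤ totalCompletionTime p e' :=
    Finset.sum_le_sum fun j _ => he'.sum_le_completionTime j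
  have h3 := mul_le_mul_of_nonneg_left h2 hK0.le
  linarith

/-! ### Single steps of the algorithm -/

/-- The jobs whose signal is still to be emitted. -/
def unsignaled (p β : Fin n → ℝ) (s : State n) : Finset (Fin n) :=
  open Classical in Finset.univ.filter fun j => j ∉ s.served ∧ s.elapsed j < β j * p j

/-- The uncompleted jobs. -/
def unfinished (p : Fin n → ℝ) (s : State n) : Finset (Fin n) :=
  open Classical in Finset.univ.filter fun j => Unfinished p s j

theorem mem_unsignaled {s : State n} {j : Fin n} :
    j ∈ unsignaled p β s ↔ j ∉ s.served ∧ s.elapsed j < β j * p j := by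
  simp [unsignaled]

theorem mem_unfinished {s : State n} {j : Fin n} : j ∈ unfinished p s ↔ Unfinished p s j := by
  simp [unfinished]

theorem mem_lowest {s : State n} {j : Fin n} :
    j ∈ lowest p s ↔ Unfinished p s j ∧ ∀ i, Unfinished p s i → s.elapsed j ≤ s.elapsed i := by
  simp [lowest]

theorem lowest_nonempty {s : State n} (h : ∃ j, Unfinished p s j) : (lowest p s).Nonempty := by
  obtain ⟨j, hj⟩ := h
  obtain ⟨i, hi, hmin⟩ := (unfinished p s).exists_min_image s.elapsed ⟨j, mem_unfinished.2 hj⟩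
  exact ⟨i, mem_lowest.2 ⟨mem_unfinished.1 hi, fun k hk => hmin k (mem_unfinished.2 hk)⟩⟩

theorem elapsed_eq_of_mem_lowest {s : State n} {i j : Fin n} (hi : i ∈ lowest p s)
    (hj : j ∈ lowest p s) : s.elapsed i = s.elapsed j :=
  le_antisymm ((mem_lowest.1 hi).2 j (mem_lowest.1 hj).1)
    ((mem_lowest.1 hj).2 i (mem_lowest.1 hi).1)

/-- The amounts after which some job processed by SETF meets an event. -/
def eventAmounts (p β : Fin n → ℝ) (s : State n) : Finset ℝ :=
  open Classical in
  (lowest p s).image (fun j => p j - s.elapsed j) ∪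
  ((lowest p s).filter (· ∉ s.served)).image (fun j => β j * p j - s.elapsed j) ∪
  (lowest p s ×ˢ (unfinished p s \ lowest p s)).image (fun q => s.elapsed q.2 - s.elapsed q.1)

theorem mem_eventAmounts {s : State n} {x : ℝ} :
    x ∈ eventAmounts p β s ↔ ∃ j ∈ lowest p s, p j - s.elapsed j = x ∨
      (j ∉ s.served ∧ β j * p j - s.elapsed j = x) ∨
      ∃ i, Unfinished p s i ∧ i ∉ lowest p s ∧ s.elapsed i - s.elapsed j = x := by
  simp only [eventAmounts, Finset.mem_union, Finset.mem_image, Finset.mem_filter,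
    Finset.mem_product, Finset.mem_sdiff, mem_unfinished, Prod.exists]
  constructor
  · rintro ((⟨j, hj, h⟩ | ⟨j, ⟨hj, hs⟩, h⟩) | ⟨j, i, ⟨hj, hi, hl⟩, h⟩)
    · exact ⟨j, hj, .inl h⟩
    · exact ⟨j, hj, .inr (.inl ⟨hs, h⟩)⟩
    · exact ⟨j, hj, .inr (.inr ⟨i, hi, hl, h⟩)⟩
  · rintro ⟨j, hj, h | ⟨hs, h⟩ | ⟨i, hi, hl, h⟩⟩
    · exact .inl (.inl ⟨j, hj, h⟩)
    · exact .inl (.inr ⟨j, ⟨hj, hs⟩, h⟩)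
    · exact .inr ⟨j, i, ⟨hj, hi, hl⟩, h⟩

theorem noEventBefore_iff {s : State n} {x : ℝ} :
    NoEventBefore p β s x ↔ 0 ≤ x ∧ ∀ c ∈ eventAmounts p β s, x ≤ c := by
  refine and_congr_right fun _ => ⟨fun h c hc => ?_, fun h j hj =>
    ⟨?_, fun hs => ?_, fun i hi hl => ?_⟩⟩
  · obtain ⟨j, hj, rfl | ⟨hs, rfl⟩ | ⟨i, hi, hl, rfl⟩⟩ := mem_eventAmounts.1 hc
    · linarith [(h j hj).1]
    · linarith [(h j hj).2.1 hs]
    · linarith [(h j hj).2.2 i hi hl]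
  · linarith [h _ (mem_eventAmounts.2 ⟨j, hj, .inl rfl⟩)]
  · linarith [h _ (mem_eventAmounts.2 ⟨j, hj, .inr (.inl ⟨hs, rfl⟩)⟩)]
  · linarith [h _ (mem_eventAmounts.2 ⟨j, hj, .inr (.inr ⟨i, hi, hl, rfl⟩)⟩)]

theorem eventAmounts_nonempty {s : State n} (h : ∃ j, Unfinished p s j) :
    (eventAmounts p β s).Nonempty := by
  obtain ⟨j, hj⟩ := lowest_nonempty h
  exact ⟨_, mem_eventAmounts.2 ⟨j, hj, .inl rfl⟩⟩

/-- No event lies in the past: a processed job is uncompleted and of least elapsed time, and if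
unserved it has not signaled, since no job is pending. -/
theorem isGreatest_min_eventAmounts {s : State n} (hp : ∀ j, ¬ Pending p β s j)
    (hu : ∃ j, Unfinished p s j) :
    IsGreatest {y | NoEventBefore p β s y}
      ((eventAmounts p β s).min' (eventAmounts_nonempty hu)) := by
  refine ⟨noEventBefore_iff.2 ⟨Finset.le_min' _ _ _ fun c hc => ?_,
    fun c hc => Finset.min'_le _ _ hc⟩,
    fun y hy => (noEventBefore_iff.1 hy).2 _ (Finset.min'_mem _ _)⟩
  obtain ⟨j, hj, rfl | ⟨hs, rfl⟩ | ⟨i, hi, hl, rfl⟩⟩ := mem_eventAmounts.1 hc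
  · exact sub_nonneg.2 (mem_lowest.1 hj).1.le
  · refine sub_nonneg.2 (le_of_not_ge fun h => hp j ⟨(mem_lowest.1 hj).1, h, hs⟩)
  · exact sub_nonneg.2 ((mem_lowest.1 hj).2 i hi)

/-- The algorithm is never stuck. -/
theorem exists_phase (α ρ : ℝ) (p β : Fin n → ℝ) (s : State n) :
    ∃ d r S, Phase α ρ p β s d r S := by
  by_cases hu : ∃ j, Unfinished p s j
  · by_cases hp : ∃ j, Pending p β s j
    · obtain ⟨j, hj⟩ := hp
      exact ⟨_, _, _, .prefer j hj⟩
    · exact ⟨_, _, _, .setf _ (not_exists.1 hp) hu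
        (isGreatest_min_eventAmounts (not_exists.1 hp) hu)⟩
  · exact ⟨_, _, _, .idle (not_exists.1 hu)⟩

/-- The effect of one phase on the state. -/
inductive Step (α ρ : ℝ) (p β : Fin n → ℝ) (s s' : State n) : Prop
  | prefer (j : Fin n) (hj : Pending p β s j) (hserved : ∀ i, i ∈ s'.served ↔ i = j ∨ i ∈ s.served)
      (hself : s'.elapsed j = min (s.elapsed j / (α * ρ)) (p j))
      (hother : ∀ i, i ≠ j → s'.elapsed i = s.elapsed i)
      (htime : s'.time - s.time = s'.elapsed j - s.elapsed j)
  | setf (x : ℝ) (hp : ∀ j, ¬ Pending p β s j) (hu : ∃ j, Unfinished p s j)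
      (hx : NoEventBefore p β s x) (hevent : x ∈ eventAmounts p β s)
      (hserved : s'.served = s.served)
      (hlow : ∀ i ∈ lowest p s, s'.elapsed i = s.elapsed i + x)
      (hother : ∀ i, i ∉ lowest p s → s'.elapsed i = s.elapsed i)
      (htime : s'.time - s.time = (lowest p s).card * x)
  | idle (hu : ∀ j, ¬ Unfinished p s j) (hserved : s'.served = s.served)
      (helapsed : s'.elapsed = s.elapsed) (htime : s'.time - s.time = 1)

/-- Rates and durations are needed only for the interpolation; the invariants and termination use
just this discrete form. -/
theorem Phase.step {s s' : State n} {d : ℝ} {r : Fin n → ℝ}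
    (h : Phase α ρ p β s d r s'.served) (ht : s'.time = s.time + d)
    (he : ∀ j, s'.elapsed j = s.elapsed j + d * r j) : Step α ρ p β s s' := by
  generalize hS : s'.served = S at h
  cases h with
  | prefer j hj =>
    beta_reduce at he
    have hself : s'.elapsed j = min (s.elapsed j / (α * ρ)) (p j) := by
      rw [he j, if_pos rfl, mul_one, ← min_add_add_left]
      congr 1 <;> ring
    refine .prefer j hj (by simp [hS]) hself (fun i hi => by simp [he, hi]) ?_
    rw [he j, if_pos rfl, ht]
    ring
  | setf x hp hu hx =>
    beta_reduce at he
    have hc : ((lowest p s).card : ℝ) ≠ 0 :=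
      Nat.cast_ne_zero.2 (Finset.card_pos.2 (lowest_nonempty hu)).ne'
    refine .setf x hp hu hx.1 ?_ hS (fun i hi => ?_) (fun i hi => ?_) (by rw [ht]; ring)
    · rw [hx.unique (isGreatest_min_eventAmounts hp hu)]
      exact Finset.min'_mem _ _
    · rw [he, if_pos hi]
      field_simp
    · simp [he, hi]
  | idle hu =>
    exact .idle hu hS (by ext j; simp [he]) (by rw [ht]; ring)

theorem Phase.rate_nonneg {s : State n} {d : ℝ} {r : Fin n → ℝ} {S : Finset (Fin n)}
    (h : Phase α ρ p β s d r S) (j : Fin n) : 0 ≤ r j := by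
  cases h with
  | prefer k hk => dsimp only; split_ifs <;> norm_num
  | setf x hp hu hx => dsimp only; split_ifs <;> positivity
  | idle hu => exact le_rfl

theorem Phase.sum_rate_le_one {s : State n} {d : ℝ} {r : Fin n → ℝ} {S : Finset (Fin n)}
    (h : Phase α ρ p β s d r S) : ∑ j, r j ≤ 1 := by
  cases h with
  | prefer k hk => simp
  | setf x hp hu hx =>
    have hc : ((lowest p s).card : ℝ) ≠ 0 :=
      Nat.cast_ne_zero.2 (Finset.card_pos.2 (lowest_nonempty hu)).ne'
    simp [Finset.sum_ite_mem, hc]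
  | idle hu => simp

/-- Invariant of the states reached by the algorithm. -/
structure Sound (α ρ : ℝ) (p β : Fin n → ℝ) (s : State n) : Prop where
  nonneg : ∀ j, 0 ≤ s.elapsed j
  le : ∀ j, s.elapsed j ≤ p j
  unserved : ∀ j, j ∉ s.served → s.elapsed j ≤ β j * p j
  served : ∀ j, α * ρ ≤ β j → j ∈ s.served → p j ≤ s.elapsed j

theorem Sound.initial (h : IsInstance p β) : Sound α ρ p β (State.init n) where
  nonneg _ := le_rfl
  le j := h.processing_nonneg j
  unserved j _ := mul_nonneg (h.fraction_mem j).1 (h.processing_nonneg j)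
  served _ _ hj := absurd hj (Finset.notMem_empty _)

theorem Sound.elapsed_mono (hκ : 0 < α * ρ) (hκ1 : α * ρ ≤ 1) {s s' : State n}
    (hs : Sound α ρ p β s) (h : Step α ρ p β s s') (j : Fin n) : s.elapsed j ≤ s'.elapsed j := by
  cases h with
  | prefer k hk hserved hself hother htime =>
    by_cases hj : j = k
    · subst hj
      rw [hself]
      exact le_min (le_div_self (hs.nonneg j) hκ hκ1) (hs.le j)
    · exact (hother j hj).ge
  | setf x hp hu hx hevent hserved hlow hother htime =>
    by_cases hj : j ∈ lowest p s
    · rw [hlow j hj]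
      linarith [hx.1]
    · exact (hother j hj).ge
  | idle hu hserved helapsed htime => rw [helapsed]

theorem Sound.time_mono (hκ : 0 < α * ρ) (hκ1 : α * ρ ≤ 1) {s s' : State n}
    (hs : Sound α ρ p β s) (h : Step α ρ p β s s') : s.time ≤ s'.time := by
  have hm := hs.elapsed_mono hκ hκ1 h
  cases h with
  | prefer k hk hserved hself hother htime => linarith [hm k]
  | setf x hp hu hx hevent hserved hlow hother htime =>
    have := mul_nonneg (Nat.cast_nonneg (α := ℝ) (lowest p s).card) hx.1
    linarith
  | idle hu hserved helapsed htime => linarith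

/-- The clause on served jobs is where `α * ρ ≤ β j` enters: the elapsed time is at least `β j * p
j` at the signal, so division by `α * ρ` reaches `p j`. -/
theorem Sound.step (hκ : 0 < α * ρ) (hκ1 : α * ρ ≤ 1) {s s' : State n}
    (hp0 : ∀ j, 0 ≤ p j) (hs : Sound α ρ p β s) (h : Step α ρ p β s s') : Sound α ρ p β s' := by
  have hm := hs.elapsed_mono hκ hκ1 h
  refine ⟨fun j => (hs.nonneg j).trans (hm j), fun j => ?_, fun j hj => ?_, fun j hβ hj => ?_⟩
  all_goals cases h with
  | prefer k hk hserved hself hother htime => ?_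
  | setf x hp hu hx hevent hserved hlow hother htime => ?_
  | idle hu hserved helapsed htime => ?_
  · by_cases hj : j = k
    · subst hj
      rw [hself]
      exact min_le_right _ _
    · rw [hother j hj]
      exact hs.le j
  · by_cases hj : j ∈ lowest p s
    · rw [hlow j hj]
      exact (hx.2 j hj).1
    · rw [hother j hj]
      exact hs.le j
  · rw [helapsed]
    exact hs.le j
  · rw [hserved, not_or] at hj
    rw [hother j hj.1]
    exact hs.unserved j hj.2
  · rw [hserved] at hj
    by_cases hl : j ∈ lowest p s
    · rw [hlow j hl]
      exact (hx.2 j hl).2.1 hj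
    · rw [hother j hl]
      exact hs.unserved j hj
  · rw [helapsed]
    exact hs.unserved j (hserved ▸ hj)
  · rcases (hserved j).1 hj with rfl | hj'
    · rw [hself]
      refine le_min ?_ le_rfl
      rw [le_div_iff₀ hκ]
      nlinarith [hk.2.1, mul_le_mul_of_nonneg_right hβ (hp0 j)]
    · exact (hs.served j hβ hj').trans (hm j)
  · exact (hs.served j hβ (hserved ▸ hj)).trans (hm j)
  · exact (hs.served j hβ (hserved ▸ hj)).trans (hm j)

theorem Step.served_mono {s s' : State n} (h : Step α ρ p β s s') {j : Fin n}
    (hj : j ∈ s.served) : j ∈ s'.served := by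
  cases h with
  | prefer k hk hserved hself hother htime => exact (hserved j).2 (.inr hj)
  | setf x hp hu hx hevent hserved hlow hother htime => rwa [hserved]
  | idle hu hserved helapsed htime => rwa [hserved]

/-- A step serves at most one job. -/
theorem Step.eq_of_newly_served {s s' : State n} (h : Step α ρ p β s s') {i j : Fin n}
    (hi : i ∉ s.served) (hj : j ∉ s.served) (hi' : i ∈ s'.served) (hj' : j ∈ s'.served) :
    i = j := by
  cases h with
  | prefer k hk hserved hself hother htime =>
    rw [((hserved i).1 hi').resolve_right hi, ((hserved j).1 hj').resolve_right hj]
  | setf x hp hu hx hevent hserved hlow hother htime => exact absurd hi' (by rwa [hserved])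
  | idle hu hserved helapsed htime => exact absurd hi' (by rwa [hserved])

/-! ### The state up to the completion of a job -/

/-- Invariant of the states up to the one in which job `i` is completed. -/
structure Leads (α ρ : ℝ) (p β : Fin n → ℝ) (i : Fin n) (s : State n) : Prop where
  time_eq : s.time = ∑ j, s.elapsed j
  le_of_unserved : ∀ j, j ∉ s.served → s.elapsed j ≤ s.elapsed i
  mul_le : ∀ j, α * ρ * s.elapsed j ≤ s.elapsed i
  le_signal : α * ρ ≤ β i → ∀ j, j ∉ s.served → s.elapsed j ≤ β i * p i
  signal_le : α * ρ ≤ β i → ∀ j, j ∈ s.served → β j * p j ≤ β i * p i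

theorem Leads.initial (h : IsInstance p β) (i : Fin n) : Leads α ρ p β i (State.init n) where
  time_eq := Finset.sum_const_zero.symm
  le_of_unserved _ _ := le_rfl
  mul_le _ := (mul_zero _).le
  le_signal _ _ _ := mul_nonneg (h.fraction_mem i).1 (h.processing_nonneg i)
  signal_le _ _ hj := absurd hj (Finset.notMem_empty _)

/-- While `i` is uncompleted, SETF stops at the level of `i`, so unserved jobs stay below it. A job
about to be served is therefore below `i`, and serving it costs at most the factor `1 / (α * ρ)`. If
`α * ρ ≤ β i`, then `i` is itself unserved, so that level is at most `β i * p i`. Only the old state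
must have `i` uncompleted, so the invariant survives the step that completes `i`. -/
theorem Leads.step (hκ : 0 < α * ρ) (hκ1 : α * ρ ≤ 1) {s s' : State n} {i : Fin n}
    (hp0 : ∀ j, 0 ≤ p j) (hs : Sound α ρ p β s) (hi : Unfinished p s i)
    (hl : Leads α ρ p β i s) (h : Step α ρ p β s s') : Leads α ρ p β i s' := by
  have hm := hs.elapsed_mono hκ hκ1 h
  have hs' := hs.step hκ hκ1 hp0 h
  have hi_unserved (hβ : α * ρ ≤ β i) : i ∉ s.served := fun hmem =>
    absurd (hs.served i hβ hmem) (not_le.2 hi)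
  cases h with
  | prefer k hk hserved hself hother htime =>
    have hki : s.elapsed k ≤ s.elapsed i := hl.le_of_unserved k hk.2.2
    have hunserved : ∀ j, j ∉ s'.served → j ∉ s.served ∧ s'.elapsed j = s.elapsed j := by
      intro j hj
      rw [hserved, not_or] at hj
      exact ⟨hj.2, hother j hj.1⟩
    refine ⟨?_, fun j hj => ?_, fun j => ?_, fun hβ j hj => ?_, fun hβ j hj => ?_⟩
    · have : ∑ j, (s'.elapsed j - s.elapsed j) = s'.elapsed k - s.elapsed k :=
        Finset.sum_eq_single k (fun j _ hj => by rw [hother j hj, sub_self]) (by simp)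
      rw [Finset.sum_sub_distrib] at this
      linarith [hl.time_eq]
    · obtain ⟨h1, h2⟩ := hunserved j hj
      rw [h2]
      exact (hl.le_of_unserved j h1).trans (hm i)
    · by_cases hj : j = k
      · subst hj
        have : s'.elapsed j ≤ s.elapsed j / (α * ρ) := hself ▸ min_le_left _ _
        rw [le_div_iff₀ hκ] at this
        linarith [hm i]
      · rw [hother j hj]
        exact (hl.mul_le j).trans (hm i)
    · obtain ⟨h1, h2⟩ := hunserved j hj
      rw [h2]
      exact hl.le_signal hβ j h1
    · rcases (hserved j).1 hj with rfl | hj'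
      · exact hk.2.1.trans (hl.le_signal hβ j hk.2.2)
      · exact hl.signal_le hβ j hj'
  | setf x hp hu hx hevent hserved hlow hother htime =>
    have hcatch : ∀ j ∈ lowest p s, s'.elapsed j ≤ s'.elapsed i := by
      intro j hj
      by_cases hil : i ∈ lowest p s
      · rw [hlow j hj, hlow i hil, elapsed_eq_of_mem_lowest hj hil]
      · rw [hlow j hj, hother i hil]
        exact (hx.2 j hj).2.2 i hi hil
    have hle : ∀ j, j ∉ s'.served → s'.elapsed j ≤ s'.elapsed i := by
      intro j hj
      by_cases hjl : j ∈ lowest p s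
      · exact hcatch j hjl
      · rw [hother j hjl]
        exact (hl.le_of_unserved j (hserved ▸ hj)).trans (hm i)
    refine ⟨?_, hle, fun j => ?_, fun hβ j hj => ?_, fun hβ j hj => ?_⟩
    · have : ∑ j, (s'.elapsed j - s.elapsed j) = ∑ j ∈ lowest p s, x := by
        rw [← Finset.sum_subset (Finset.subset_univ (lowest p s))
          (fun j _ hj => by rw [hother j hj, sub_self])]
        exact Finset.sum_congr rfl fun j hj => by rw [hlow j hj]; ring
      rw [Finset.sum_sub_distrib, Finset.sum_const, nsmul_eq_mul] at this
      linarith [hl.time_eq]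
    · by_cases hjl : j ∈ lowest p s
      · have := mul_le_of_le_one_left (hs'.nonneg j) hκ1
        linarith [hcatch j hjl]
      · rw [hother j hjl]
        exact (hl.mul_le j).trans (hm i)
    · exact (hle j hj).trans (hs'.unserved i (hserved ▸ hi_unserved hβ))
    · exact hl.signal_le hβ j (hserved ▸ hj)
  | idle hu hserved helapsed htime => exact absurd hi (hu i)

/-! ### Termination -/

/-- A measure that decreases in every step before all jobs are completed. -/
def potential (p β : Fin n → ℝ) (s : State n) : ℕ :=
  (n + 1) * ((unfinished p s).card + s.servedᶜ.card + (unsignaled p β s).card) +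
    (unfinished p s \ lowest p s).card

/-- A preferential execution uses up an unserved job. A SETF phase ends with a completion, a signal
or a catch-up; the last enlarges the lowest group. Durations would not serve as a measure, because a
preferential execution may have length zero. -/
theorem potential_lt (hκ : 0 < α * ρ) (hκ1 : α * ρ ≤ 1) {s s' : State n}
    (hs : Sound α ρ p β s) (h : Step α ρ p β s s') (hu : ∃ j, Unfinished p s j) :
    potential p β s' < potential p β s := by
  have hm := hs.elapsed_mono hκ hκ1 h
  have hU : unfinished p s' ⊆ unfinished p s := fun j hj =>
    mem_unfinished.2 ((hm j).trans_lt (mem_unfinished.1 hj))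
  have hV : s'.servedᶜ ⊆ s.servedᶜ :=
    Finset.compl_subset_compl.2 fun j hj => h.served_mono hj
  have hS : unsignaled p β s' ⊆ unsignaled p β s := by
    intro j hj
    rw [mem_unsignaled] at hj ⊢
    exact ⟨fun hmem => hj.1 (h.served_mono hmem), (hm j).trans_lt hj.2⟩
  have hUc := Finset.card_le_card hU
  have hVc := Finset.card_le_card hV
  have hSc := Finset.card_le_card hS
  have hW : (unfinished p s' \ lowest p s').card ≤ n := by
    simpa using Finset.card_le_univ (unfinished p s' \ lowest p s')
  -- The weight `n + 1` outweighs any growth of the last term, which is at most `n`.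
  have drop : (unfinished p s').card + s'.servedᶜ.card + (unsignaled p β s').card <
      (unfinished p s).card + s.servedᶜ.card + (unsignaled p β s).card →
      potential p β s' < potential p β s := by
    intro hlt
    have := Nat.mul_le_mul_left (n + 1) (Nat.succ_le_of_lt hlt)
    unfold potential
    rw [Nat.succ_eq_add_one, mul_add] at this
    omega
  cases h with
  | prefer k hk hserved hself hother htime =>
    have : s'.servedᶜ.card < s.servedᶜ.card := Finset.card_lt_card <|
      (Finset.ssubset_iff_of_subset hV).2 ⟨k, by simpa using hk.2.2, by simp [hserved]⟩
    exact drop (by omega)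
  | setf x hp _ hx hevent hserved hlow hother htime =>
    by_cases hUeq : unfinished p s' = unfinished p s
    swap
    · have := Finset.card_lt_card (hU.ssubset_of_ne hUeq)
      exact drop (by omega)
    obtain ⟨j, hj, hjx | ⟨hjs, hjx⟩ | ⟨i, hi, hil, hjx⟩⟩ := mem_eventAmounts.1 hevent
    · have h1 : j ∈ unfinished p s' := hUeq ▸ mem_unfinished.2 (mem_lowest.1 hj).1
      have h2 : s'.elapsed j < p j := mem_unfinished.1 h1
      rw [hlow j hj] at h2
      linarith
    · have : (unsignaled p β s').card < (unsignaled p β s).card := by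
        refine Finset.card_lt_card ((Finset.ssubset_iff_of_subset hS).2 ⟨j, ?_, ?_⟩)
        · exact mem_unsignaled.2 ⟨hjs, lt_of_not_ge fun hge => hp j ⟨(mem_lowest.1 hj).1, hge, hjs⟩⟩
        · rw [mem_unsignaled, hlow j hj]
          intro hlt
          linarith [hlt.2]
      exact drop (by omega)
    -- Catch-up: the old lowest jobs remain lowest, and `i` joins them.
    · have hmin : ∀ k, Unfinished p s' k → s.elapsed j + x ≤ s'.elapsed k := by
        intro k hk
        by_cases hkl : k ∈ lowest p s
        · rw [hlow k hkl, elapsed_eq_of_mem_lowest hj hkl]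
        · rw [hother k hkl]
          exact (hx.2 j hj).2.2 k (mem_unfinished.1 (hU (mem_unfinished.2 hk))) hkl
      have hnew : ∀ k, Unfinished p s k → s'.elapsed k = s.elapsed j + x → k ∈ lowest p s' := by
        intro k hk hke
        refine mem_lowest.2 ⟨mem_unfinished.1 (hUeq ▸ mem_unfinished.2 hk), fun l hl => ?_⟩
        rw [hke]
        exact hmin l hl
      have : (unfinished p s' \ lowest p s').card < (unfinished p s \ lowest p s).card := by
        refine Finset.card_lt_card ((Finset.ssubset_iff_of_subset ?_).2 ⟨i, ?_, ?_⟩)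
        · rw [hUeq]
          refine Finset.sdiff_subset_sdiff subset_rfl fun k hk => ?_
          exact hnew k (mem_lowest.1 hk).1 (by rw [hlow k hk, elapsed_eq_of_mem_lowest hk hj])
        · exact Finset.mem_sdiff.2 ⟨mem_unfinished.2 hi, hil⟩
        · exact fun hmem => (Finset.mem_sdiff.1 hmem).2
            (hnew i hi (by rw [hother i hil]; linarith))
      unfold potential
      rw [hUeq] at this ⊢
      rw [hserved]
      have := Nat.mul_le_mul_left (n + 1)
        (Nat.add_le_add_left hSc ((unfinished p s).card + s.servedᶜ.card))
      omega
  | idle hall hserved helapsed htime => exact absurd hu (not_exists.2 hall)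

/-! ### Runs -/

/-- A sequence of states that the algorithm may pass through. -/
structure IsRun (α ρ : ℝ) (p β : Fin n → ℝ) (s : ℕ → State n) : Prop where
  start : s 0 = State.init n
  step : ∀ m, Step α ρ p β (s m) (s (m + 1))

section Run

variable {s : ℕ → State n}

theorem IsRun.sound (hκ : 0 < α * ρ) (hκ1 : α * ρ ≤ 1) (hI : IsInstance p β)
    (h : IsRun α ρ p β s) (m : ℕ) : Sound α ρ p β (s m) := by
  induction m with
  | zero => exact h.start ▸ Sound.initial hI
  | succ m ih => exact ih.step hκ hκ1 hI.processing_nonneg (h.step m)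

theorem IsRun.time_mono (hκ : 0 < α * ρ) (hκ1 : α * ρ ≤ 1) (hI : IsInstance p β)
    (h : IsRun α ρ p β s) : Monotone fun m => (s m).time :=
  monotone_nat_of_le_succ fun m => (h.sound hκ hκ1 hI m).time_mono hκ hκ1 (h.step m)

theorem IsRun.elapsed_mono (hκ : 0 < α * ρ) (hκ1 : α * ρ ≤ 1) (hI : IsInstance p β)
    (h : IsRun α ρ p β s) (j : Fin n) : Monotone fun m => (s m).elapsed j :=
  monotone_nat_of_le_succ fun m => (h.sound hκ hκ1 hI m).elapsed_mono hκ hκ1 (h.step m) j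

theorem IsRun.exists_all_finished (hκ : 0 < α * ρ) (hκ1 : α * ρ ≤ 1) (hI : IsInstance p β)
    (h : IsRun α ρ p β s) : ∃ m, ∀ j, ¬ Unfinished p (s m) j := by
  by_contra! hcon
  have hbound : ∀ m, potential p β (s m) + m ≤ potential p β (s 0) := by
    intro m
    induction m with
    | zero => exact le_rfl
    | succ m ih =>
      have := potential_lt hκ hκ1 (h.sound hκ hκ1 hI m) (h.step m) (hcon m)
      omega
  have := hbound (potential p β (s 0) + 1)
  omega

/-- Once all jobs are completed, every phase idles for one unit, so the phases cover all times `t ≥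
0`. -/
theorem IsRun.exists_lt_time (hκ : 0 < α * ρ) (hκ1 : α * ρ ≤ 1) (hI : IsInstance p β)
    (h : IsRun α ρ p β s) (t : ℝ) : ∃ m, t < (s m).time := by
  obtain ⟨N, hN⟩ := h.exists_all_finished hκ hκ1 hI
  have hidle : ∀ k, (∀ j, ¬ Unfinished p (s (N + k)) j) ∧
      (s (N + k)).time = (s N).time + k := by
    intro k
    induction k with
    | zero => exact ⟨hN, by simp⟩
    | succ k ih =>
      rw [← add_assoc]
      refine ⟨fun j hj => ih.1 j ?_, ?_⟩
      · exact lt_of_le_of_lt (h.elapsed_mono hκ hκ1 hI j (Nat.le_succ (N + k))) hj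
      · cases h.step (N + k) with
        | prefer k hk hserved hself hother htime => exact absurd hk.1 (ih.1 k)
        | setf x hp hu hx hevent hserved hlow hother htime =>
          exact absurd hu (not_exists.2 ih.1)
        | idle hu hserved helapsed htime =>
          push_cast
          linarith [ih.2]
  obtain ⟨k, hk⟩ := exists_nat_gt (t - (s N).time)
  exact ⟨N + k, by linarith [(hidle k).2]⟩

/-- The index of the first state in which job `j` is completed. -/
def finishIndex (p : Fin n → ℝ) (s : ℕ → State n) (j : Fin n) : ℕ :=
  sInf {m | ¬ Unfinished p (s m) j}

theorem unfinished_of_lt_finishIndex {j : Fin n} {m : ℕ} (h : m < finishIndex p s j) :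
    Unfinished p (s m) j := by
  by_contra hc
  exact Nat.notMem_of_lt_sInf h hc

theorem finishIndex_le {j : Fin n} {m : ℕ} (h : ¬ Unfinished p (s m) j) :
    finishIndex p s j ≤ m :=
  Nat.sInf_le h

theorem IsRun.finished_finishIndex (hκ : 0 < α * ρ) (hκ1 : α * ρ ≤ 1) (hI : IsInstance p β)
    (h : IsRun α ρ p β s) (j : Fin n) : p j ≤ (s (finishIndex p s j)).elapsed j := by
  obtain ⟨m, hm⟩ := h.exists_all_finished hκ hκ1 hI
  exact not_lt.1 (Nat.sInf_mem (s := {m | ¬ Unfinished p (s m) j}) ⟨m, hm j⟩)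

theorem IsRun.leads (hκ : 0 < α * ρ) (hκ1 : α * ρ ≤ 1) (hI : IsInstance p β)
    (h : IsRun α ρ p β s) (j : Fin n) : Leads α ρ p β j (s (finishIndex p s j)) := by
  suffices H : ∀ m ≤ finishIndex p s j, Leads α ρ p β j (s m) from H _ le_rfl
  intro m
  induction m with
  | zero => exact fun _ => h.start ▸ Leads.initial hI j
  | succ m ih =>
    intro hm
    exact (ih (by omega)).step hκ hκ1 hI.processing_nonneg (h.sound hκ hκ1 hI m)
      (unfinished_of_lt_finishIndex (by omega)) (h.step m)

/-- The delay that job `i` causes to job `j`. -/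
def delay (p : Fin n → ℝ) (s : ℕ → State n) (i j : Fin n) : ℝ :=
  (s (finishIndex p s j)).elapsed i

/-- Job `i` delays `j` by at most `p i`; when `i` completes, `Leads.mul_le` bounds the elapsed time
of `j` by `p i / (α * ρ)`. -/
theorem IsRun.mutual_delay_le (hκ : 0 < α * ρ) (hκ1 : α * ρ ≤ 1) (hI : IsInstance p β)
    (h : IsRun α ρ p β s) (i j : Fin n) :
    delay p s i j + delay p s j i ≤ (1 + 1 / (α * ρ)) * p i := by
  have h1 : delay p s i j ≤ p i := (h.sound hκ hκ1 hI _).le i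
  have h2 : delay p s j i ≤ p i / (α * ρ) := by
    rw [le_div_iff₀ hκ, mul_comm]
    exact ((h.leads hκ hκ1 hI i).mul_le j).trans ((h.sound hκ hκ1 hI _).le i)
  calc _ ≤ p i + p i / (α * ρ) := add_le_add h1 h2
    _ = _ := by ring

/-- Jobs whose signals are not too early are completed by their preferential execution. -/
theorem IsRun.mutual_delay_le_of_signal (hα : 0 < α) (hα1 : α ≤ 1) (hκ : 0 < α * ρ)
    (hκ1 : α * ρ ≤ 1) (hI : IsInstance p β) (h : IsRun α ρ p β s) {i j : Fin n} (hij : i ≠ j)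
    (hi : α * ρ ≤ β i) (hj : α * ρ ≤ β j) :
    delay p s i j + delay p s j i ≤
      (1 + α) * p i + 2 / α * (|β i - α| * p i + |β j - α| * p j) := by
  have hηi : (β i - α) * p i ≤ |β i - α| * p i :=
    mul_le_mul_of_nonneg_right (le_abs_self _) (hI.processing_nonneg i)
  have hηj : (α - β j) * p j ≤ |β j - α| * p j :=
    mul_le_mul_of_nonneg_right (by rw [abs_sub_comm]; exact le_abs_self _) (hI.processing_nonneg j)
  have hηi0 : 0 ≤ |β i - α| * p i := mul_nonneg (abs_nonneg _) (hI.processing_nonneg i)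
  have hηj0 : 0 ≤ |β j - α| * p j := mul_nonneg (abs_nonneg _) (hI.processing_nonneg j)
  set ηi := |β i - α| * p i
  set ηj := |β j - α| * p j
  have hα' : ηi + ηj ≤ (ηi + ηj) / α := le_div_self (add_nonneg hηi0 hηj0) hα hα1
  have hc : 2 / α * (ηi + ηj) = 2 * ((ηi + ηj) / α) := by ring
  rw [hc]
  by_cases hserved : j ∈ (s (finishIndex p s i)).served
  -- If each were served by the completion of the other, both would complete at the same index and
  -- be served in the same step, which serves only one job.
  · have hiunserved : i ∉ (s (finishIndex p s j)).served := by
      intro hmem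
      have h1 : finishIndex p s j ≤ finishIndex p s i :=
        finishIndex_le (not_lt.2 ((h.sound hκ hκ1 hI _).served j hj hserved))
      have h2 : finishIndex p s i ≤ finishIndex p s j :=
        finishIndex_le (not_lt.2 ((h.sound hκ hκ1 hI _).served i hi hmem))
      have heq := le_antisymm h2 h1
      rw [← heq] at hmem
      rcases hM : finishIndex p s i with _ | M
      · rw [hM, h.start] at hmem
        exact absurd hmem (Finset.notMem_empty _)
      · have hunserved : ∀ k, α * ρ ≤ β k → M < finishIndex p s k → k ∉ (s M).served :=
          fun k hk hlt hmem => absurd ((h.sound hκ hκ1 hI M).served k hk hmem)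
            (not_le.2 (unfinished_of_lt_finishIndex hlt))
        rw [hM] at hmem hserved
        exact hij ((h.step M).eq_of_newly_served (hunserved i hi (by omega))
          (hunserved j hj (by omega)) hmem hserved)
    have h1 : delay p s i j ≤ β i * p i := (h.sound hκ hκ1 hI _).unserved i hiunserved
    have h2 : delay p s j i ≤ p j := (h.sound hκ hκ1 hI _).le j
    have h3 : β j * p j ≤ β i * p i := (h.leads hκ hκ1 hI i).signal_le hi j hserved
    -- From `β j * p j ≤ β i * p i`, replacing both fractions by `α` costs `ηi + ηj`.
    have h4 : p j - p i ≤ (ηi + ηj) / α := by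
      rw [le_div_iff₀ hα]
      linarith
    linarith
  · have h1 : delay p s i j ≤ p i := (h.sound hκ hκ1 hI _).le i
    have h2 : delay p s j i ≤ β i * p i := (h.leads hκ hκ1 hI i).le_signal hi j hserved
    linarith

end Run

/-! ### Executions -/

/-- A sequence of phases that the algorithm may perform, with the states between them. -/
structure IsPhaseSequence (α ρ : ℝ) (p β : Fin n → ℝ) (s : ℕ → State n) (d : ℕ → ℝ)
    (r : ℕ → Fin n → ℝ) : Prop where
  start : s 0 = State.init n
  phase : ∀ m, Phase α ρ p β (s m) (d m) (r m) (s (m + 1)).served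
  time : ∀ m, (s (m + 1)).time = (s m).time + d m
  elapsed : ∀ m j, (s (m + 1)).elapsed j = (s m).elapsed j + d m * r m j

theorem exists_isPhaseSequence (α ρ : ℝ) (p β : Fin n → ℝ) :
    ∃ s d r, IsPhaseSequence α ρ p β s d r := by
  choose d r S hS using exists_phase α ρ p β
  let next (s : State n) : State n := ⟨s.time + d s, fun j => s.elapsed j + d s * r s j, S s⟩
  let s (m : ℕ) : State n := next^[m] (State.init n)
  have hs (m : ℕ) : s (m + 1) = next (s m) := Function.iterate_succ_apply' _ _ _
  refine ⟨s, fun m => d (s m), fun m => r (s m), rfl, fun m => ?_, fun m => ?_, fun m j => ?_⟩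
  · rw [hs]
    exact hS (s m)
  · rw [hs]
  · rw [hs]

/-- `e` interpolates the elapsed times linearly between the states. -/
def Interpolates (s : ℕ → State n) (r : ℕ → Fin n → ℝ) (e : Fin n → ℝ → ℝ) : Prop :=
  ∀ m j, ∀ t ∈ Set.Icc (s m).time (s (m + 1)).time,
    e j t = (s m).elapsed j + (t - (s m).time) * r m j

theorem isExecution_iff {e : Fin n → ℝ → ℝ} :
    IsExecution α ρ p β e ↔
      ∃ s d r, IsPhaseSequence α ρ p β s d r ∧ Interpolates s r e :=
  ⟨fun ⟨s, d, r, h0, h⟩ => ⟨s, d, r, ⟨h0, fun m => (h m).1, fun m => (h m).2.1,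
    fun m => (h m).2.2.1⟩, fun m => (h m).2.2.2⟩,
  fun ⟨s, d, r, h, he⟩ => ⟨s, d, r, h.start, fun m => ⟨h.phase m, h.time m, h.elapsed m, he m⟩⟩⟩

section

variable {s : ℕ → State n} {d : ℕ → ℝ} {r : ℕ → Fin n → ℝ}

theorem IsPhaseSequence.isRun (h : IsPhaseSequence α ρ p β s d r) : IsRun α ρ p β s :=
  ⟨h.start, fun m => (h.phase m).step (h.time m) (h.elapsed m)⟩

/-- Phases of length zero can separate two pieces that meet at a common time; they change no elapsed
time. -/
theorem IsPhaseSequence.elapsed_eq_of_time_eq (hκ : 0 < α * ρ) (hκ1 : α * ρ ≤ 1)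
    (hI : IsInstance p β) (h : IsPhaseSequence α ρ p β s d r) {k m : ℕ} (hkm : k ≤ m)
    (ht : (s m).time = (s k).time) (j : Fin n) : (s m).elapsed j = (s k).elapsed j := by
  induction m, hkm using Nat.le_induction with
  | base => rfl
  | succ m hkm ih =>
    have hmono := h.isRun.time_mono hκ hκ1 hI
    have h1 : (s k).time ≤ (s m).time := hmono hkm
    have h2 : (s m).time ≤ (s (m + 1)).time := hmono (Nat.le_succ m)
    have hd : d m = 0 := by linarith [h.time m]
    rw [h.elapsed, hd, zero_mul, add_zero, ih (by linarith)]

/-- The linear pieces agree where their time intervals meet. -/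
theorem IsPhaseSequence.pieces_agree (hκ : 0 < α * ρ) (hκ1 : α * ρ ≤ 1)
    (hI : IsInstance p β) (h : IsPhaseSequence α ρ p β s d r) {k m : ℕ} (hkm : k ≤ m) {t : ℝ}
    (hk : t ∈ Set.Icc (s k).time (s (k + 1)).time) (hm : t ∈ Set.Icc (s m).time (s (m + 1)).time)
    (j : Fin n) : (s k).elapsed j + (t - (s k).time) * r k j =
      (s m).elapsed j + (t - (s m).time) * r m j := by
  rcases hkm.eq_or_lt with rfl | hlt
  · rfl
  have h1 : (s (k + 1)).time ≤ (s m).time := h.isRun.time_mono hκ hκ1 hI hlt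
  have htk : t = (s (k + 1)).time := le_antisymm hk.2 (h1.trans hm.1)
  have htm : t = (s m).time := le_antisymm (hk.2.trans h1) hm.1
  have he := h.elapsed_eq_of_time_eq hκ hκ1 hI (Nat.succ_le_of_lt hlt) (htm.symm.trans htk) j
  rw [← htm, sub_self, zero_mul, add_zero, he, Nat.succ_eq_add_one, h.elapsed, htk, h.time]
  ring

theorem IsPhaseSequence.exists_interpolates (hκ : 0 < α * ρ) (hκ1 : α * ρ ≤ 1)
    (hI : IsInstance p β) (h : IsPhaseSequence α ρ p β s d r) : ∃ e, Interpolates s r e := by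
  classical
  -- Any piece containing `t` may be chosen, since they agree. The default `0` concerns negative
  -- times only.
  refine ⟨fun j t => if ht : ∃ m, t ∈ Set.Icc (s m).time (s (m + 1)).time then
    (s ht.choose).elapsed j + (t - (s ht.choose).time) * r ht.choose j else 0,
    fun m j t hm => ?_⟩
  have ht : ∃ m, t ∈ Set.Icc (s m).time (s (m + 1)).time := ⟨m, hm⟩
  beta_reduce
  rw [dif_pos ht]
  rcases le_total ht.choose m with hle | hle
  · exact h.pieces_agree hκ hκ1 hI hle ht.choose_spec hm j
  · exact (h.pieces_agree hκ hκ1 hI hle hm ht.choose_spec j).symm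

theorem IsPhaseSequence.interpolates_at (hκ : 0 < α * ρ) (hκ1 : α * ρ ≤ 1)
    (hI : IsInstance p β) (h : IsPhaseSequence α ρ p β s d r) {e : Fin n → ℝ → ℝ}
    (he : Interpolates s r e) (m : ℕ) (j : Fin n) : e j (s m).time = (s m).elapsed j := by
  rw [he m j _ ⟨le_rfl, h.isRun.time_mono hκ hκ1 hI (Nat.le_succ m)⟩]
  ring

theorem IsPhaseSequence.time_nonneg (hκ : 0 < α * ρ) (hκ1 : α * ρ ≤ 1)
    (hI : IsInstance p β) (h : IsPhaseSequence α ρ p β s d r) (m : ℕ) : 0 ≤ (s m).time := by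
  have : (s 0).time ≤ (s m).time := h.isRun.time_mono hκ hκ1 hI (Nat.zero_le m)
  rwa [h.start] at this

/-- Monotonicity and the speed limit hold between any two times. -/
theorem IsPhaseSequence.progress (hκ : 0 < α * ρ) (hκ1 : α * ρ ≤ 1)
    (hI : IsInstance p β) (h : IsPhaseSequence α ρ p β s d r) {e : Fin n → ℝ → ℝ}
    (he : Interpolates s r e) {u t : ℝ} (hu : 0 ≤ u) (hut : u ≤ t) :
    (∀ j, e j u ≤ e j t) ∧ ∑ j, (e j t - e j u) ≤ t - u := by
  have hmono := h.isRun.time_mono hκ hκ1 hI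
  have within : ∀ m, ∀ u t : ℝ, (s m).time ≤ u → u ≤ t → t ≤ (s (m + 1)).time →
      (∀ j, e j u ≤ e j t) ∧ ∑ j, (e j t - e j u) ≤ t - u := by
    intro m u t h1 h2 h3
    have hdiff : ∀ j, e j t - e j u = (t - u) * r m j := by
      intro j
      rw [he m j t ⟨h1.trans h2, h3⟩, he m j u ⟨h1, h2.trans h3⟩]
      ring
    refine ⟨fun j => ?_, ?_⟩
    · rw [← sub_nonneg, hdiff]
      exact mul_nonneg (sub_nonneg.2 h2) ((h.phase m).rate_nonneg j)
    · simp only [hdiff, ← Finset.mul_sum]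
      exact mul_le_of_le_one_right (sub_nonneg.2 h2) (h.phase m).sum_rate_le_one
  suffices H : ∀ m, ∀ u t : ℝ, 0 ≤ u → u ≤ t → t ≤ (s m).time →
      (∀ j, e j u ≤ e j t) ∧ ∑ j, (e j t - e j u) ≤ t - u by
    obtain ⟨m, hm⟩ := h.isRun.exists_lt_time hκ hκ1 hI t
    exact H m u t hu hut hm.le
  intro m
  induction m with
  | zero =>
    intro u t hu hut ht
    rw [h.start] at ht
    have : u = t := le_antisymm hut (ht.trans hu)
    simp [this]
  | succ m ih =>
    intro u t hu hut ht
    rcases le_total t (s m).time with h1 | h1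
    · exact ih u t hu hut h1
    rcases le_total (s m).time u with h2 | h2
    · exact within m u t h2 hut ht
    obtain ⟨a1, a2⟩ := ih u _ hu h2 le_rfl
    obtain ⟨b1, b2⟩ := within m _ t le_rfl h1 ht
    refine ⟨fun j => (a1 j).trans (b1 j), ?_⟩
    simp only [Finset.sum_sub_distrib] at a2 b2 ⊢
    linarith

theorem IsPhaseSequence.isSchedule (hκ : 0 < α * ρ) (hκ1 : α * ρ ≤ 1)
    (hI : IsInstance p β) (h : IsPhaseSequence α ρ p β s d r) {e : Fin n → ℝ → ℝ}
    (he : Interpolates s r e) : IsSchedule p e where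
  start j := by
    have := h.interpolates_at hκ hκ1 hI he 0 j
    rwa [h.start] at this
  mono j _ _ hu hut := (h.progress hκ hκ1 hI he hu hut).1 j
  speed _ _ hu hut := (h.progress hκ hκ1 hI he hu hut).2
  completes j := ⟨_, h.time_nonneg hκ hκ1 hI (finishIndex p s j), by
    rw [h.interpolates_at hκ hκ1 hI he]
    exact h.isRun.finished_finishIndex hκ hκ1 hI j⟩

/-- The machine is fully used until `j` completes, so that time equals the total processing done. -/
theorem IsPhaseSequence.completionTime_le (hκ : 0 < α * ρ) (hκ1 : α * ρ ≤ 1)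
    (hI : IsInstance p β) (h : IsPhaseSequence α ρ p β s d r) {e : Fin n → ℝ → ℝ}
    (he : Interpolates s r e) (j : Fin n) :
    completionTime p e j ≤ ∑ i, delay p s i j := by
  refine (SignalScheduling.completionTime_le (h.time_nonneg hκ hκ1 hI (finishIndex p s j))
    ?_).trans (h.isRun.leads hκ hκ1 hI j).time_eq.le
  rw [h.interpolates_at hκ hκ1 hI he]
  exact h.isRun.finished_finishIndex hκ hκ1 hI j

end

theorem isWellDefined (hκ : 0 < α * ρ) (hκ1 : α * ρ ≤ 1) :
    IsWellDefined (IsExecution α ρ) := by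
  intro n p β hI
  refine ⟨?_, fun e he => ?_⟩
  · obtain ⟨s, d, r, h⟩ := exists_isPhaseSequence α ρ p β
    obtain ⟨e, he⟩ := h.exists_interpolates hκ hκ1 hI
    exact ⟨e, isExecution_iff.2 ⟨s, d, r, h, he⟩⟩
  · obtain ⟨s, d, r, h, he⟩ := isExecution_iff.1 he
    exact h.isSchedule hκ hκ1 hI he

/-- A bound on the mutual delays in all runs bounds the cost of every execution. -/
theorem IsExecution.totalCompletionTime_le (hκ : 0 < α * ρ) (hκ1 : α * ρ ≤ 1)
    (hI : IsInstance p β) {e : Fin n → ℝ → ℝ} (he : IsExecution α ρ p β e) {K : ℝ} (hK : 1 ≤ K)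
    {err : Fin n → ℝ} (herr : ∀ j, 0 ≤ err j)
    (hpair : ∀ s, IsRun α ρ p β s → ∀ i j, i ≠ j → p i ≤ p j →
      delay p s i j + delay p s j i ≤ K * p i + (err i + err j)) :
    totalCompletionTime p e ≤ K * OPT p + n * ∑ i, err i := by
  obtain ⟨s, d, r, h, he⟩ := isExecution_iff.1 he
  exact totalCompletionTime_le_of_mutual_delay (h.isSchedule hκ hκ1 hI he) hK
    hI.processing_nonneg herr (h.completionTime_le hκ hκ1 hI he)
    (fun j => (h.isRun.sound hκ hκ1 hI _).le j) (hpair s h.isRun)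

theorem isConsistent (hα : α ∈ Set.Ioc (0 : ℝ) 1) (hρ : ρ ∈ Set.Ioc (0 : ℝ) 1) :
    IsConsistent α (IsExecution α ρ) (1 + α) := by
  intro n p β hI hβ e he
  have hκ : 0 < α * ρ := mul_pos hα.1 hρ.1
  have hκα : α * ρ ≤ α := mul_le_of_le_one_right hα.1.le hρ.2
  have hκ1 : α * ρ ≤ 1 := hκα.trans hα.2
  simpa using he.totalCompletionTime_le hκ hκ1 hI (K := 1 + α) (by linarith [hα.1])
    (err := fun _ => 0) (fun _ => le_rfl) fun s hs i j hij _ => by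
      simpa [hβ] using hs.mutual_delay_le_of_signal hα.1 hα.2 hκ hκ1 hI hij
        (by rwa [hβ]) (by rwa [hβ])

theorem isRobust (hκ : 0 < α * ρ) (hκ1 : α * ρ ≤ 1) :
    IsRobust (IsExecution α ρ) (1 + 1 / (ρ * α)) := by
  intro n p β hI e he
  have hpos : 0 < 1 / (α * ρ) := one_div_pos.2 hκ
  rw [mul_comm ρ α]
  simpa using he.totalCompletionTime_le hκ hκ1 hI (K := 1 + 1 / (α * ρ)) (by linarith)
    (err := fun _ => 0) (fun _ => le_rfl) fun s hs i j _ _ => by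
      simpa using hs.mutual_delay_le hκ hκ1 hI i j

/-- The robustness bound is paid for by the prediction error of a job with an early signal. -/
theorem one_div_mul_le_of_early_signal (hα : 0 < α) (hρ : 0 < ρ) (hρ1 : ρ < 1) {b q q' : ℝ}
    (hq : 0 ≤ q) (hqq' : q ≤ q') (hb : b < α * ρ) :
    1 / (α * ρ) * q ≤ 1 / (ρ * (1 - ρ) * α ^ 2) * (|b - α| * q') := by
  have h1ρ : 0 < 1 - ρ := sub_pos.2 hρ1
  have habs : α * (1 - ρ) ≤ |b - α| := by
    rw [abs_sub_comm]
    exact le_trans (by linarith) (le_abs_self _)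
  calc 1 / (α * ρ) * q = 1 / (ρ * (1 - ρ) * α ^ 2) * (α * (1 - ρ) * q) := by
        field_simp
    _ ≤ _ := mul_le_mul_of_nonneg_left
        (mul_le_mul habs hqq' hq (abs_nonneg _)) (by positivity)

theorem IsExecution.totalCompletionTime_le_error (hα : α ∈ Set.Ioc (0 : ℝ) 1)
    (hρ : ρ ∈ Set.Ioo (0 : ℝ) 1) (hI : IsInstance p β) {e : Fin n → ℝ → ℝ}
    (he : IsExecution α ρ p β e) :
    totalCompletionTime p e ≤
      (1 + α) * OPT p + 2 * n / (ρ * (1 - ρ) * α ^ 2) * ∑ i, |β i - α| * p i := by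
  obtain ⟨hα0, hα1⟩ := hα
  obtain ⟨hρ0, hρ1⟩ := hρ
  have h1ρ : 0 < 1 - ρ := sub_pos.2 hρ1
  have hκ : 0 < α * ρ := mul_pos hα0 hρ0
  have hκ1 : α * ρ ≤ 1 := mul_le_one₀ hα1 hρ0.le hρ1.le
  have hc : 0 ≤ 1 / (ρ * (1 - ρ) * α ^ 2) := by positivity
  -- One constant must cover both regimes: `2 / α` for late enough signals and the larger one for
  -- early signals.
  have hcα : 1 / α ≤ 1 / (ρ * (1 - ρ) * α ^ 2) := by
    refine one_div_le_one_div_of_le (by positivity) ?_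
    have h1 : ρ * (1 - ρ) ≤ 1 := mul_le_one₀ hρ1.le h1ρ.le (by linarith)
    calc ρ * (1 - ρ) * α ^ 2 ≤ 1 * α ^ 2 := mul_le_mul_of_nonneg_right h1 (by positivity)
      _ ≤ α := by nlinarith
  set c := 1 / (ρ * (1 - ρ) * α ^ 2)
  have hη : ∀ j, 0 ≤ |β j - α| * p j := fun j =>
    mul_nonneg (abs_nonneg _) (hI.processing_nonneg j)
  have key := he.totalCompletionTime_le hκ hκ1 hI (K := 1 + α) (by linarith)
    (err := fun j => 2 * c * (|β j - α| * p j))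
    (fun j => mul_nonneg (by positivity) (hη j)) fun s hs i j hij hpij => by
      have hαp := mul_nonneg hα0.le (hI.processing_nonneg i)
      have hci := mul_nonneg hc (hη i)
      have hcj := mul_nonneg hc (hη j)
      have hrob := hs.mutual_delay_le hκ hκ1 hI i j
      -- With an early signal of either job, the robustness bound exceeds `p i` by `1 / (α * ρ) * p
      -- i`, which the error of that job covers; for `j` this uses `p i ≤ p j`.
      rcases lt_or_ge (β i) (α * ρ) with hi | hi
      · linarith [one_div_mul_le_of_early_signal hα0 hρ0 hρ1 (hI.processing_nonneg i) le_rfl hi]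
      rcases lt_or_ge (β j) (α * ρ) with hj | hj
      · linarith [one_div_mul_le_of_early_signal hα0 hρ0 hρ1 (hI.processing_nonneg i) hpij hj]
      have hsig := hs.mutual_delay_le_of_signal hα0 hα1 hκ hκ1 hI hij hi hj
      have hmul := mul_le_mul_of_nonneg_right hcα (add_nonneg (hη i) (hη j))
      have h2 : 2 / α * (|β i - α| * p i + |β j - α| * p j) =
        2 * (1 / α * (|β i - α| * p i + |β j - α| * p j)) := by ring
      linarith
  refine key.trans_eq ?_
  rw [← Finset.mul_sum]
  simp only [c]
  ring

end SignalScheduling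

end

theorem mainTheorem1 (α ρ : ℝ) (hα : α ∈ Set.Ioc (0 : ℝ) 1) (hρ : ρ ∈ Set.Ioc (0 : ℝ) 1) :
    SignalScheduling.IsWellDefined (SignalScheduling.IsExecution α ρ) ∧
    SignalScheduling.IsConsistent α (SignalScheduling.IsExecution α ρ) (1 + α) ∧
    SignalScheduling.IsRobust (SignalScheduling.IsExecution α ρ) (1 + 1 / (ρ * α)) ∧
    (ρ < 1 → ∀ (n : ℕ) (p β : Fin n → ℝ), SignalScheduling.IsInstance p β →
      ∀ e, SignalScheduling.IsExecution α ρ p β e →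
        SignalScheduling.totalCompletionTime p e ≤
          (1 + α) * SignalScheduling.OPT p +
            2 * n / (ρ * (1 - ρ) * α ^ 2) * ∑ i, |β i - α| * p i) := by
  have hκ : 0 < α * ρ := mul_pos hα.1 hρ.1
  have hκ1 : α * ρ ≤ 1 := mul_le_one₀ hα.2 hρ.1.le hρ.2
  exact ⟨SignalScheduling.isWellDefined hκ hκ1, SignalScheduling.isConsistent hα hρ,
    SignalScheduling.isRobust hκ hκ1, fun hρ1 _ _ _ hI _ he =>
      he.totalCompletionTime_le_error hα ⟨hρ.1, hρ1⟩ hI⟩
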